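/- Let $T>0$. A set-valued map $F\colon\mathbb R\to\mathcal P(\mathbb R)$ is monotone increasing if $(y_2-y_1)(u_2-u_1)\ge 0$ for all $u_1\ne u_2$, $y_1\in F(u_1)$, $y_2\in F(u_2)$, and maximal monotone increasing if moreover no monotone increasing map has a strictly larger graph. Let $G\colon\mathbb R\times\mathbb R\to\mathcal P(\mathbb R)$ satisfy the following structural assumptions. (S1) $G(t,u)=-\mathcal A(t,u)+p(t,u)$, where - $\mathcal A\colon\mathbb R\times\mathbb R\to\mathcal P(\mathbb R)\setminus\{\emptyset\}$ is $T$-periodic in $t$, maximal monotone increasing in $u$ for every $t$, measurable in $t$ for every $u$, and locally bounded by a measurable function, i.e. for every $r$ there is a measurable $m_r\colon\mathbb R\to\mathbb R$ such that, for almost every $t$, $|y|\le m_r(t)$ for all $|u|\le r$ and $y\in\mathcal A(t,u)$; - $p\colon\mathbb R\times\mathbb R\to\mathbb R$ is a Carathéodory function (measurable in $t$ for every $u$, continuous in $u$ for every $t$), $T$-periodic in $t$, and locally Lipschitz continuous in $u$ uniformly in $t$, i.e. for every $r$ there is $L_r$ such that $p(t,\cdot)$ is $L_r$-Lipschitz on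 $[-r,r]$ for all $t$. (S2) There are $R>0$ and two $T$-periodic measurable functions $\ell_d^\pm\colon\mathbb R\to\mathbb R$, integrable on $(0,T)$, with $\int_0^T\ell_d^\pm(s)\,ds<0$, such that for almost every $t\in\mathbb R$: $y\ge-\ell_d^-(t)$ for all $u\le-R$, $y\in G(t,u)$; and $y\le\ell_d^+(t)$ for all $u\ge R$, $y\in G(t,u)$. A solution of $\dot v\in G(t,v)$ on an interval is a function that is absolutely continuous on each compact subinterval and satisfies the inclusion at almost every $t$ of the interval. Let $v_-=-R-\|\ell_d^-\|_{L^1(0,T)}$ and $v_+=R+\|\ell_d^+\|_{L^1(0,T)}$. Let $\Phi_T$ be the Poincaré map, which sends $x_0$ to the value $x(T)$ of the solution $x$ on $[0,T]$ with $x(0)=x_0$ (for a set $S$, $\Phi_T(S)$ is the set of the values $x(T)$ of all solutions $x$ on $[0,T]$ with $x(0)\in S$), and let $$K=\bigcap_{i\in\mathbb N}\Phi_T^i([v_-,v_+]).$$ Then, for every $t_0\in\mathbb R$ and every solution $v$ of $\dot v\in G(t,v)$ on $[t_0,+\infty)$, there exists a $T$-periodic solution $v^*\colon\mathbb R\to\mathbb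 R$ of $\dot v\in G(t,v)$ such that $v^*(0)\in K$ and $$\lim_{t\to+\infty}\bigl(v(t)-v^*(t)\bigr)=0.$$ -/

import Mathlib

open MeasureTheory Set Filter Topology

noncomputable section

namespace PeriodicInclusion

/-- The graph of a set-valued map `F : ℝ → 𝒫(ℝ)`. -/
def graph (F : ℝ → Set ℝ) : Set (ℝ × ℝ) :=
  {z | z.2 ∈ F z.1}

/-- Monotone increasing set-valued maps. -/
def MonotoneIncreasing (F : ℝ → Set ℝ) : Prop :=
  ∀ u₁ u₂ : ℝ, u₁ ≠ u₂ → ∀ y₁ ∈ F u₁, ∀ y₂ ∈ F u₂, 0 ≤ (y₂ - y₁) * (u₂ - u₁)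

/-- Maximal monotone increasing set-valued maps: no monotone increasing map has a strictly larger
graph. -/
def MaximalMonotoneIncreasing (F : ℝ → Set ℝ) : Prop :=
  MonotoneIncreasing F ∧
    ¬ ∃ F' : ℝ → Set ℝ, MonotoneIncreasing F' ∧ graph F ⊂ graph F'

/-- Lebesgue measurability of a set-valued map `Γ : ℝ → 𝒫(ℝ)`: preimages of open sets are
Lebesgue measurable. -/
def MeasurableSetValued (Γ : ℝ → Set ℝ) : Prop :=
  ∀ U : Set ℝ, IsOpen U → NullMeasurableSet {t | (Γ t ∩ U).Nonempty} volume

/-- The properties required of the maximal monotone part `A` of `G`.  Here and below,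
`AEMeasurable` with respect to Lebesgue measure is Lebesgue measurability of a function. -/
structure IsMonotonePart (T : ℝ) (A : ℝ → ℝ → Set ℝ) : Prop where
  nonempty : ∀ t u, (A t u).Nonempty
  locally_bounded : ∀ r : ℝ, ∃ m : ℝ → ℝ, AEMeasurable m volume ∧
    ∀ᵐ t ∂volume, ∀ u ∈ Icc (-r) r, ∀ y ∈ A t u, |y| ≤ m t
  periodic : ∀ t u, A (t + T) u = A t u
  maximal_monotone : ∀ t, MaximalMonotoneIncreasing (A t)
  measurable : ∀ u, MeasurableSetValued (fun t => A t u)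

/-- The properties required of the single-valued part `p` of `G`: a `T`-periodic Carathéodory
function, Lipschitz in `u` on bounded sets, uniformly in `t`. -/
structure IsLipschitzPart (T : ℝ) (p : ℝ → ℝ → ℝ) : Prop where
  measurable : ∀ u, AEMeasurable (fun t => p t u) volume
  continuous : ∀ t, Continuous (p t)
  periodic : ∀ t u, p (t + T) u = p t u
  locally_lipschitz : ∀ r : ℝ, ∃ L : NNReal, ∀ t, LipschitzOnWith L (p t) (Icc (-r) r)

/-- First structural assumption: `G(t,u) = -A(t,u) + p(t,u)`. -/
def StructuralS1 (T : ℝ) (G : ℝ → ℝ → Set ℝ) : Prop :=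
  ∃ (A : ℝ → ℝ → Set ℝ) (p : ℝ → ℝ → ℝ), IsMonotonePart T A ∧ IsLipschitzPart T p ∧
    ∀ t u, G t u = {y | ∃ a ∈ A t u, y = -a + p t u}

/-- Second structural assumption, with its data `R`, `ℓ⁻` and `ℓ⁺`. -/
structure StructuralS2 (T : ℝ) (G : ℝ → ℝ → Set ℝ) (R : ℝ) (lm lp : ℝ → ℝ) : Prop where
  R_pos : 0 < R
  measurable_lm : AEMeasurable lm volume
  measurable_lp : AEMeasurable lp volume
  periodic_lm : Function.Periodic lm T
  periodic_lp : Function.Periodic lp T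
  integrable_lm : IntervalIntegrable lm volume 0 T
  integrable_lp : IntervalIntegrable lp volume 0 T
  integral_lm_neg : ∫ s in (0 : ℝ)..T, lm s < 0
  integral_lp_neg : ∫ s in (0 : ℝ)..T, lp s < 0
  lower : ∀ᵐ t ∂volume, ∀ u ∈ Iic (-R), ∀ y ∈ G t u, -lm t ≤ y
  upper : ∀ᵐ t ∂volume, ∀ u ∈ Ici R, ∀ y ∈ G t u, y ≤ lp t

/-- `v` is a solution of `v' ∈ G(t,v)` on the interval `I`: it is absolutely continuous on every
compact subinterval of `I`, and at almost every `t ∈ I` its derivative exists and belongs to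
`G(t,v(t))`. -/
def IsSolutionOn (G : ℝ → ℝ → Set ℝ) (v : ℝ → ℝ) (I : Set ℝ) : Prop :=
  (∀ a b : ℝ, a ≤ b → Icc a b ⊆ I → AbsolutelyContinuousOnInterval v a b) ∧
    ∀ᵐ t ∂volume, t ∈ I → ∃ y ∈ G t (v t), HasDerivAt v y t

/-- The Poincaré map `Φ_T`, written as the set of all values `x(T)` of solutions `x` on `[0,T]`
with `x(0) = x₀`.  It is the singleton `{x(T; x₀)}` whenever the initial value problem has
exactly one solution on `[0,T]`. -/
def poincare (T : ℝ) (G : ℝ → ℝ → Set ℝ) (x₀ : ℝ) : Set ℝ :=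
  {y | ∃ x : ℝ → ℝ, IsSolutionOn G x (Icc 0 T) ∧ x 0 = x₀ ∧ x T = y}

/-- The image `Φ_T(S)` of a set under the Poincaré map. -/
def poincareImage (T : ℝ) (G : ℝ → ℝ → Set ℝ) (S : Set ℝ) : Set ℝ :=
  ⋃ x₀ ∈ S, poincare T G x₀

/-- `v₋ = -R - ‖ℓ⁻‖_{L¹(0,T)}`. -/
def vMinus (T R : ℝ) (lm : ℝ → ℝ) : ℝ :=
  -R - ∫ s in (0 : ℝ)..T, |lm s|

/-- `v₊ = R + ‖ℓ⁺‖_{L¹(0,T)}`. -/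
def vPlus (T R : ℝ) (lp : ℝ → ℝ) : ℝ :=
  R + ∫ s in (0 : ℝ)..T, |lp s|

/-- The attractor `K = ⋂ᵢ Φ_Tⁱ([v₋, v₊])`. -/
def attractor (T : ℝ) (G : ℝ → ℝ → Set ℝ) (R : ℝ) (lm lp : ℝ → ℝ) : Set ℝ :=
  ⋂ i : ℕ, (poincareImage T G)^[i] (Icc (vMinus T R lm) (vPlus T R lp))

end PeriodicInclusion

end

/-!
Convergence to periodic solutions of a scalar `T`-periodic differential inclusion
`v' ∈ G(t, v) = -A(t, v) + p(t, v)`, with `A` maximal monotone and `p` locally Lipschitz.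

The difference `d` of two bounded solutions satisfies `d' d ≤ L d²`, because the monotone part only
contributes with the good sign (`IsSolutionOn.isOneSidedLipschitz_sub`). Hence solutions are unique
forward in time and keep their order. A solution `v` and its translate `v(· + T)` are therefore
ordered, and the translates `v(· + nT)` form a monotone sequence
(`IsSolutionOn.monotone_or_antitone`). The sequence is bounded: a solution which does not decrease
over one period cannot stay in the region where the averaged drift is negative, so it ends that
period below `v₊`, and symmetrically for `v₋` (`StructuralS2.le_vPlus`, `StructuralS2.vMinus_le`).
So `v(t + nT)` converges for every `t`, to a `T`-periodic function `w`.

The main point is that `w` is a solution, although `G` need not have an integrable bound. For two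
ordered solutions, `e^{-Lt} (u₂ - u₁)(t)` is monotone in `t`, so its total variation is at most its
initial value. Consecutive translates have summable initial differences, so `e^{-Lt} v(t + nT)` is a
Cauchy sequence for the total variation norm. Its limit is absolutely continuous, the derivatives
converge almost everywhere, and the graph of a maximal monotone map is closed
(`IsSolutionOn.of_tendsto`).

The bounds `v₋` and `v₊` apply to `w` as well, and `w 0` is its own image under the Poincaré map, so
that `w 0` lies in the attractor. Grönwall's inequality over one period makes the convergence of the
translates uniform on a period, which is `v - w → 0`.
-/

open MeasureTheory Set Filter Topology

namespace PeriodicInclusion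

/-! ### Absolutely continuous functions -/

theorem absolutelyContinuousOnInterval_comp_add_right {f : ℝ → ℝ} {a b c : ℝ}
    (hf : AbsolutelyContinuousOnInterval f (a + c) (b + c)) :
    AbsolutelyContinuousOnInterval (fun t => f (t + c)) a b := by
  rw [absolutelyContinuousOnInterval_iff] at hf ⊢
  intro ε hε
  obtain ⟨δ, hδ, H⟩ := hf ε hε
  refine ⟨δ, hδ, fun E hE hlen => ?_⟩
  refine H (E.1, fun i => ((E.2 i).1 + c, (E.2 i).2 + c)) ⟨fun i hi => ?_, fun i hi j hj hij => ?_⟩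
    (by simpa using hlen)
  · have := hE.1 i hi
    simpa only [← image_add_const_uIcc, mem_image, add_left_inj, exists_eq_right] using this
  · have := hE.2 hi hj hij
    simp only [Function.onFun, uIoc, min_add_add_right, max_add_add_right,
      ← image_add_const_Ioc] at this ⊢
    exact (disjoint_image_iff (add_left_injective c)).2 this

theorem ae_comp_add_right {P : ℝ → Prop} (h : ∀ᵐ t ∂volume, P t) (c : ℝ) :
    ∀ᵐ t ∂volume, P (t + c) :=
  (measurePreserving_add_right volume c).quasiMeasurePreserving.ae h

theorem sub_le_integral_of_hasDerivAt_le {f q : ℝ → ℝ} {a b : ℝ} (hab : a ≤ b)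
    (hf : AbsolutelyContinuousOnInterval f a b) (hq : IntervalIntegrable q volume a b)
    (h : ∀ᵐ t ∂volume, t ∈ Ioo a b → ∃ y ≤ q t, HasDerivAt f y t) :
    f b - f a ≤ ∫ t in a..b, q t := by
  rw [← hf.integral_deriv_eq_sub]
  refine intervalIntegral.integral_mono_ae_restrict hab hf.intervalIntegrable_deriv hq ?_
  rw [← restrict_Ioo_eq_restrict_Icc]
  refine (ae_restrict_iff' measurableSet_Ioo).2 ?_
  filter_upwards [h] with t ht hmem
  obtain ⟨y, hy, hd⟩ := ht hmem
  rwa [hd.deriv]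

theorem le_of_hasDerivAt_nonpos {f : ℝ → ℝ} {a b : ℝ} (hab : a ≤ b)
    (hf : AbsolutelyContinuousOnInterval f a b)
    (h : ∀ᵐ t ∂volume, t ∈ Ioo a b → ∃ y ≤ 0, HasDerivAt f y t) : f b ≤ f a := by
  have := sub_le_integral_of_hasDerivAt_le (q := fun _ => 0) hab hf (by simp) h
  simp at this
  linarith

/-- Only the values `t` with `R ≤ z t` are controlled. If `z` does not decrease over the interval,
it cannot stay above `R`, and after its last visit to `(-∞, R]` it grows by at most
`∫ |q|`. -/
theorem le_add_integral_abs_of_drift {z q : ℝ → ℝ} {a b R : ℝ} (hab : a ≤ b)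
    (hz : AbsolutelyContinuousOnInterval z a b) (hq : IntervalIntegrable q volume a b)
    (hneg : ∫ t in a..b, q t < 0)
    (h : ∀ᵐ t ∂volume, t ∈ Icc a b → R ≤ z t → ∃ y ≤ q t, HasDerivAt z y t)
    (hle : z a ≤ z b) : z b ≤ R + ∫ t in a..b, |q t| := by
  have hcont : ContinuousOn z (Icc a b) := by simpa [uIcc_of_le hab] using hz.continuousOn
  by_cases hall : ∀ t ∈ Icc a b, R ≤ z t
  · have := sub_le_integral_of_hasDerivAt_le hab hz hq (by
      filter_upwards [h] with t ht hmem
      exact ht (Ioo_subset_Icc_self hmem) (hall t (Ioo_subset_Icc_self hmem)))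
    linarith
  · push Not at hall
    obtain ⟨t₁, ht₁, hlt⟩ := hall
    have hcomp : IsCompact (Icc a b ∩ z ⁻¹' Iic R) :=
      isCompact_Icc.of_isClosed_subset
        (hcont.preimage_isClosed_of_isClosed isClosed_Icc isClosed_Iic) inter_subset_left
    obtain ⟨τ, ⟨hτ, hτR⟩, hmax⟩ := hcomp.exists_isGreatest ⟨t₁, ht₁, hlt.le⟩
    have hsub : uIcc τ b ⊆ uIcc a b := by
      rw [uIcc_of_le hτ.2, uIcc_of_le hab]
      exact Icc_subset_Icc_left hτ.1
    have hqτ : IntervalIntegrable q volume τ b := hq.mono_set hsub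
    have h1 := sub_le_integral_of_hasDerivAt_le hτ.2 (hz.mono hsub) hqτ (by
      filter_upwards [h] with t ht hmem
      have htI : t ∈ Icc a b := ⟨hτ.1.trans hmem.1.le, hmem.2.le⟩
      refine ht htI (le_of_not_ge fun hcon => ?_)
      exact absurd (hmax ⟨htI, hcon⟩) (not_le.2 hmem.1))
    have h2 : ∫ t in τ..b, q t ≤ ∫ t in τ..b, |q t| :=
      intervalIntegral.integral_mono_on hτ.2 hqτ hqτ.abs fun t _ => le_abs_self _
    have h3 : ∫ t in τ..b, |q t| ≤ ∫ t in a..b, |q t| :=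
      intervalIntegral.integral_mono_interval hτ.1 hτ.2 le_rfl
        (Eventually.of_forall fun t => abs_nonneg _) hq.abs
    have h4 : z τ ≤ R := hτR
    linarith

/-! ### Limits of absolutely continuous functions -/

theorem ae_summable_of_summable_integral_norm {α : Type*} [MeasurableSpace α] {μ : Measure α}
    {F : ℕ → α → ℝ} (hF : ∀ i, Integrable (F i) μ) (hs : Summable fun i => ∫ x, ‖F i x‖ ∂μ) :
    (∀ᵐ x ∂μ, Summable fun i => F i x) ∧ Integrable (fun x => ∑' i, F i x) μ := by
  have hfin : ∫⁻ x, ∑' i, ‖F i x‖ₑ ∂μ ≠ ⊤ := by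
    rw [lintegral_tsum fun i => (hF i).1.enorm]
    have (i : ℕ) : ∫⁻ x, ‖F i x‖ₑ ∂μ = ENNReal.ofReal (∫ x, ‖F i x‖ ∂μ) := by
      rw [ofReal_integral_norm_eq_lintegral_enorm (hF i)]
    simp_rw [this]
    exact hs.tsum_ofReal_ne_top
  have hsum : ∀ᵐ x ∂μ, Summable fun i => F i x := by
    filter_upwards [ae_lt_top' (AEMeasurable.tsum fun i => (hF i).1.enorm) hfin] with x hx
    refine Summable.of_norm ?_
    have : (∑' i, (‖F i x‖₊ : ENNReal)) ≠ ⊤ := hx.ne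
    exact NNReal.summable_coe.2 (ENNReal.tsum_coe_ne_top_iff_summable.1 this)
  refine ⟨hsum, ?_, ?_⟩
  · refine aestronglyMeasurable_of_tendsto_ae atTop
      (f := fun n x => ∑ i ∈ Finset.range n, F i x)
      (fun n => Finset.aestronglyMeasurable_fun_sum _ fun i _ => (hF i).1) ?_
    filter_upwards [hsum] with x hx using hx.hasSum.tendsto_sum_nat
  · refine lt_of_le_of_lt (lintegral_mono fun x => ?_) hfin.lt_top
    exact enorm_tsum_le_tsum_enorm

/-- Absolutely continuous functions are complete for the total variation norm. -/
theorem absolutelyContinuousOnInterval_of_summable_variation {g : ℕ → ℝ → ℝ} {w : ℝ → ℝ}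
    {a b : ℝ} (hab : a ≤ b) (hg : ∀ n, AbsolutelyContinuousOnInterval (g n) a b)
    (hw : ∀ t ∈ Icc a b, Tendsto (fun n => g n t) atTop (𝓝 (w t)))
    (hs : Summable fun n => ∫ t in a..b, |deriv (g (n + 1)) t - deriv (g n) t|) :
    AbsolutelyContinuousOnInterval w a b ∧
      ∀ᵐ t ∂volume, t ∈ Ioo a b →
        ∃ y, HasDerivAt w y t ∧ Tendsto (fun n => deriv (g n) t) atTop (𝓝 y) := by
  -- the limit is the primitive of `h = g₀' + ∑ (gₙ₊₁' - gₙ')`, a series converging in `L¹`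
  set F : ℕ → ℝ → ℝ := fun n t => deriv (g (n + 1)) t - deriv (g n) t with hFdef
  have hFi (n : ℕ) : IntervalIntegrable (F n) volume a b :=
    (hg (n + 1)).intervalIntegrable_deriv.sub (hg n).intervalIntegrable_deriv
  have hF (n : ℕ) : IntegrableOn (F n) (Ioc a b) volume :=
    (intervalIntegrable_iff_integrableOn_Ioc_of_le hab).1 (hFi n)
  have hs' : Summable fun n => ∫ t in Ioc a b, ‖F n t‖ := by
    simpa only [intervalIntegral.integral_of_le hab, Real.norm_eq_abs, hFdef] using hs
  obtain ⟨hae, hint⟩ := ae_summable_of_summable_integral_norm hF hs'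
  have hSi : IntervalIntegrable (fun t => ∑' n, F n t) volume a b :=
    (intervalIntegrable_iff_integrableOn_Ioc_of_le hab).2 hint
  set h : ℝ → ℝ := fun t => deriv (g 0) t + ∑' n, F n t with hh
  have h0i := (hg 0).intervalIntegrable_deriv
  have hhi : IntervalIntegrable h volume a b := h0i.add hSi
  have key (t : ℝ) (ht : t ∈ Icc a b) : w t = w a + ∫ s in a..t, h s := by
    have hsub : uIcc a t ⊆ uIcc a b := by
      rw [uIcc_of_le ht.1, uIcc_of_le hab]
      exact Icc_subset_Icc_right ht.2
    have hsubI : Ioc a t ⊆ Ioc a b := Ioc_subset_Ioc_right ht.2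
    have hsum : HasSum (fun n => ∫ s in Ioc a t, F n s) (∫ s in Ioc a t, ∑' n, F n s) := by
      refine hasSum_integral_of_summable_integral_norm (fun n => (hF n).mono_set hsubI) ?_
      refine Summable.of_nonneg_of_le (fun n => integral_nonneg fun s => norm_nonneg _)
        (fun n => ?_) hs'
      exact setIntegral_mono_set (hF n).norm (Eventually.of_forall fun s => norm_nonneg _)
        hsubI.eventuallyLE
    have hval (n : ℕ) : ∫ s in Ioc a t, F n s = (g (n + 1) t - g (n + 1) a) - (g n t - g n a) := by
      rw [← intervalIntegral.integral_of_le ht.1, intervalIntegral.integral_sub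
        (((hg _).mono hsub).intervalIntegrable_deriv) (((hg _).mono hsub).intervalIntegrable_deriv),
        ((hg _).mono hsub).integral_deriv_eq_sub, ((hg _).mono hsub).integral_deriv_eq_sub]
    have hlim := hsum.tendsto_sum_nat
    simp_rw [hval] at hlim
    have haI : a ∈ Icc a b := ⟨le_rfl, hab⟩
    have hlim2 : Tendsto (fun N => ∑ i ∈ Finset.range N,
        ((g (i + 1) t - g (i + 1) a) - (g i t - g i a))) atTop
        (𝓝 ((w t - w a) - (g 0 t - g 0 a))) := by
      simp_rw [Finset.sum_range_sub (fun i => g i t - g i a)]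
      exact ((hw t ht).sub (hw a haI)).sub_const _
    have heq := tendsto_nhds_unique hlim hlim2
    have : ∫ s in a..t, h s = (g 0 t - g 0 a) + ∫ s in Ioc a t, ∑' n, F n s := by
      rw [intervalIntegral.integral_add (h0i.mono_set hsub) (hSi.mono_set hsub),
        ((hg 0).mono hsub).integral_deriv_eq_sub, intervalIntegral.integral_of_le ht.1]
    rw [this, heq]
    ring
  have hwac : AbsolutelyContinuousOnInterval w a b := by
    have h1 := hhi.absolutelyContinuousOnInterval_intervalIntegral (left_mem_uIcc (a := a) (b := b))
    rw [absolutelyContinuousOnInterval_iff] at h1 ⊢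
    intro ε hε
    obtain ⟨δ, hδ, H⟩ := h1 ε hε
    refine ⟨δ, hδ, fun E hE hlen => ?_⟩
    refine lt_of_eq_of_lt (Finset.sum_congr rfl fun i hi => ?_) (H E hE hlen)
    have hm := hE.1 i hi
    rw [uIcc_of_le hab] at hm
    rw [key _ hm.1, key _ hm.2, dist_add_left]
  refine ⟨hwac, ?_⟩
  have hae' : ∀ᵐ t ∂volume, t ∈ Ioc a b → Summable fun n => F n t :=
    (ae_restrict_iff' measurableSet_Ioc).1 hae
  filter_upwards [hae', hhi.ae_hasDerivAt_integral] with t hsumm hder hmem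
  refine ⟨h t, ?_, ?_⟩
  · have h1 := (hder (by rw [uIcc_of_le hab]; exact Ioo_subset_Icc_self hmem) a
      left_mem_uIcc).const_add (w a)
    refine h1.congr_of_eventuallyEq ?_
    filter_upwards [Icc_mem_nhds hmem.1 hmem.2] with s hsI using key s hsI
  · have h1 := (hsumm (Ioo_subset_Ioc_self hmem)).hasSum.tendsto_sum_nat
    simp_rw [hFdef, Finset.sum_range_sub (fun i => deriv (g i) t)] at h1
    have h2 := h1.const_add (deriv (g 0) t)
    simpa [hh, hFdef] using h2

/-! ### Differences of solutions of one-sided Lipschitz inclusions -/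

/-- `d` is absolutely continuous on `[a,b]` and satisfies `d' d ≤ L d²`, as the difference of two
solutions of a one-sided Lipschitz differential inclusion does. -/
structure IsOneSidedLipschitz (L : ℝ) (d : ℝ → ℝ) (a b : ℝ) : Prop where
  ac : AbsolutelyContinuousOnInterval d a b
  deriv_mul_le : ∀ᵐ t ∂volume, t ∈ Ioo a b → ∃ y, HasDerivAt d y t ∧ y * d t ≤ L * d t ^ 2

section

variable {L : ℝ} {d : ℝ → ℝ} {a b : ℝ}

theorem IsOneSidedLipschitz.neg (h : IsOneSidedLipschitz L d a b) :
    IsOneSidedLipschitz L (-d) a b := by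
  refine ⟨h.ac.neg, ?_⟩
  filter_upwards [h.deriv_mul_le] with t ht hmem
  obtain ⟨y, hy, hle⟩ := ht hmem
  exact ⟨-y, hy.neg, by simpa using hle⟩

theorem IsOneSidedLipschitz.mono (h : IsOneSidedLipschitz L d a b) {s t : ℝ} (has : a ≤ s)
    (hst : s ≤ t) (htb : t ≤ b) : IsOneSidedLipschitz L d s t := by
  refine ⟨h.ac.mono ?_, ?_⟩
  · rw [uIcc_of_le hst, uIcc_of_le (has.trans (hst.trans htb))]
    exact Icc_subset_Icc has htb
  · filter_upwards [h.deriv_mul_le] with r hr hmem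
    exact hr ⟨has.trans_lt hmem.1, hmem.2.trans_le htb⟩

theorem absolutelyContinuousOnInterval_exp_mul (c : ℝ) :
    AbsolutelyContinuousOnInterval (fun t => Real.exp (c * t)) a b :=
  ContDiffOn.absolutelyContinuousOnInterval (by fun_prop)

theorem hasDerivAt_exp_mul (c t : ℝ) :
    HasDerivAt (fun t => Real.exp (c * t)) (Real.exp (c * t) * c) t := by
  simpa using ((hasDerivAt_id t).const_mul c).exp

/-- Grönwall's inequality. -/
theorem IsOneSidedLipschitz.abs_le (h : IsOneSidedLipschitz L d a b) (hab : a ≤ b) :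
    |d b| ≤ Real.exp (L * (b - a)) * |d a| := by
  have h1 : Real.exp (-(2 * L) * b) * (d b * d b) ≤ Real.exp (-(2 * L) * a) * (d a * d a) := by
    refine le_of_hasDerivAt_nonpos (f := fun t => Real.exp (-(2 * L) * t) * (d t * d t)) hab
      ((absolutelyContinuousOnInterval_exp_mul _).fun_mul (h.ac.fun_mul h.ac)) ?_
    filter_upwards [h.deriv_mul_le] with t ht hmem
    obtain ⟨y, hy, hle⟩ := ht hmem
    refine ⟨_, ?_, (hasDerivAt_exp_mul (-(2 * L)) t).mul (hy.mul hy)⟩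
    nlinarith [Real.exp_pos (-(2 * L) * t)]
  have h2 : (d b) ^ 2 ≤ (Real.exp (L * (b - a)) * |d a|) ^ 2 := by
    rw [mul_pow, sq_abs, ← Real.exp_nat_mul]
    have h3 := mul_le_mul_of_nonneg_left h1 (Real.exp_pos (2 * L * b)).le
    rw [← mul_assoc (Real.exp _), ← mul_assoc (Real.exp _), ← Real.exp_add, ← Real.exp_add] at h3
    have e1 : 2 * L * b + -(2 * L) * b = 0 := by ring
    have e2 : 2 * L * b + -(2 * L) * a = (2 : ℕ) * (L * (b - a)) := by push_cast; ring
    rw [e1, e2, Real.exp_zero, one_mul, ← sq, ← sq] at h3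
    exact h3
  exact abs_le_of_sq_le_sq h2 (by positivity)

theorem IsOneSidedLipschitz.nonneg (h : IsOneSidedLipschitz L d a b) (ha : 0 ≤ d a) {t : ℝ}
    (ht : t ∈ Icc a b) : 0 ≤ d t := by
  by_contra! hneg
  -- `d` vanishes somewhere before `t`, hence stays zero up to `t`
  have hcont : ContinuousOn d (Icc a t) := by
    simpa [uIcc_of_le ht.1] using (h.mono le_rfl ht.1 ht.2).ac.continuousOn
  obtain ⟨s, hs, hs0⟩ := intermediate_value_Icc' ht.1 hcont ⟨hneg.le, ha⟩
  have := (h.mono hs.1 hs.2 ht.2).abs_le hs.2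
  rw [hs0, abs_zero, mul_zero] at this
  exact hneg.ne (abs_eq_zero.1 (le_antisymm this (abs_nonneg _)))

/-- The function `e^{-Lt} d(t)` keeps its sign and its absolute value does not increase, so its
total variation is bounded by its initial size. -/
theorem IsOneSidedLipschitz.integral_abs_deriv_le (h : IsOneSidedLipschitz L d a b) (hab : a ≤ b) :
    ∫ t in a..b, |deriv (fun s => Real.exp (-L * s) * d s) t| ≤ Real.exp (-L * a) * |d a| := by
  wlog ha : 0 ≤ d a generalizing d
  · have := this h.neg (by simp only [Pi.neg_apply]; linarith)
    simpa [deriv.fun_neg] using this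
  have hnn (t : ℝ) (ht : t ∈ Icc a b) : 0 ≤ d t := h.nonneg ha ht
  have hac : AbsolutelyContinuousOnInterval (fun s => Real.exp (-L * s) * d s) a b :=
    (absolutelyContinuousOnInterval_exp_mul _).fun_mul h.ac
  have hneg : ∀ᵐ t ∂volume, t ∈ Ioo a b → deriv (fun s => Real.exp (-L * s) * d s) t ≤ 0 := by
    filter_upwards [h.deriv_mul_le] with t ht hmem
    obtain ⟨y, hy, hle⟩ := ht hmem
    rw [((hasDerivAt_exp_mul (-L) t).fun_mul hy).deriv]
    have hyL : y ≤ L * d t := by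
      rcases (hnn t (Ioo_subset_Icc_self hmem)).eq_or_lt with h0 | hpos
      · -- a zero of the nonnegative function `d` is a local minimum
        have hmin : IsLocalMin d t := by
          filter_upwards [Icc_mem_nhds hmem.1 hmem.2] with s hs
          rw [← h0]
          exact hnn s hs
        rw [hmin.hasDerivAt_eq_zero hy, ← h0, mul_zero]
      · exact le_of_mul_le_mul_right (by linarith [hle, sq (d t)]) hpos
    nlinarith [Real.exp_pos (-L * t)]
  have heq : ∫ t in a..b, |deriv (fun s => Real.exp (-L * s) * d s) t| =
      ∫ t in a..b, -deriv (fun s => Real.exp (-L * s) * d s) t := by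
    refine intervalIntegral.integral_congr_ae_restrict ?_
    rw [uIoc_of_le hab, ← restrict_Ioo_eq_restrict_Ioc]
    refine (ae_restrict_iff' measurableSet_Ioo).2 ?_
    filter_upwards [hneg] with t ht hmem using abs_of_nonpos (ht hmem)
  rw [heq, intervalIntegral.integral_neg, hac.integral_deriv_eq_sub, abs_of_nonneg ha]
  have : 0 ≤ Real.exp (-L * b) * d b := mul_nonneg (Real.exp_pos _).le (hnn b ⟨hab, le_rfl⟩)
  linarith

end

/-! ### Closed graph of maximal monotone maps -/

/-- The graph of a maximal monotone increasing map is closed. -/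
theorem MaximalMonotoneIncreasing.mem_of_tendsto {F : ℝ → Set ℝ}
    (hF : MaximalMonotoneIncreasing F) {u y : ℕ → ℝ} {u₀ y₀ : ℝ} (hmem : ∀ n, y n ∈ F (u n))
    (hu : Tendsto u atTop (𝓝 u₀)) (hy : Tendsto y atTop (𝓝 y₀)) : y₀ ∈ F u₀ := by
  by_contra hnot
  have key (u' : ℝ) (hne : u' ≠ u₀) (y' : ℝ) (hy' : y' ∈ F u') : 0 ≤ (y' - y₀) * (u' - u₀) := by
    refine ge_of_tendsto ((hy.const_sub y').mul (hu.const_sub u')) ?_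
    filter_upwards [hu.eventually_ne hne.symm] with n hn
    exact hF.1 _ _ hn _ (hmem n) _ hy'
  -- otherwise the point `(u₀, y₀)` could be added to the graph
  refine hF.2 ⟨fun u' => {y' | y' ∈ F u' ∨ u' = u₀ ∧ y' = y₀}, ?_, ?_⟩
  · rintro u₁ u₂ hne y₁ (h₁ | ⟨rfl, rfl⟩) y₂ (h₂ | ⟨rfl, rfl⟩)
    · exact hF.1 u₁ u₂ hne y₁ h₁ y₂ h₂
    · linarith [key u₁ hne y₁ h₁]
    · exact key u₂ hne.symm y₂ h₂
    · exact absurd rfl hne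
  · refine ⟨fun z hz => Or.inl hz, fun hsub => hnot ?_⟩
    exact hsub (show (u₀, y₀) ∈ _ from Or.inr ⟨rfl, rfl⟩)

/-! ### Solutions -/

variable {T : ℝ} {G : ℝ → ℝ → Set ℝ}

theorem IsSolutionOn.mono {v : ℝ → ℝ} {I J : Set ℝ} (h : IsSolutionOn G v J) (hIJ : I ⊆ J) :
    IsSolutionOn G v I :=
  ⟨fun a b hab hI => h.1 a b hab (hI.trans hIJ), h.2.mono fun _ ht hI => ht (hIJ hI)⟩

theorem isSolutionOn_univ {v : ℝ → ℝ} (h : ∀ a b : ℝ, a ≤ b → IsSolutionOn G v (Icc a b)) :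
    IsSolutionOn G v univ := by
  refine ⟨fun a b hab _ => (h a b hab).1 a b hab Subset.rfl, ?_⟩
  have hall : ∀ᵐ t ∂volume, ∀ n : ℕ, t ∈ Icc (-n : ℝ) n → ∃ y ∈ G t (v t), HasDerivAt v y t :=
    ae_all_iff.2 fun n => (h (-n) n (by linarith [n.cast_nonneg (α := ℝ)])).2
  filter_upwards [hall] with t ht _
  obtain ⟨n, hn⟩ := exists_nat_ge |t|
  exact ht n (abs_le.1 hn)

theorem periodic_of_structuralS1 (hS1 : StructuralS1 T G) (u : ℝ) :
    Function.Periodic (fun t => G t u) T := by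
  obtain ⟨A, p, hA, hp, hG⟩ := hS1
  intro t
  simp only [hG, hA.periodic, hp.periodic]

theorem IsSolutionOn.comp_add_nat_mul {v : ℝ → ℝ} {I J : Set ℝ}
    (hper : ∀ u, Function.Periodic (fun t => G t u) T) (h : IsSolutionOn G v J) (n : ℕ)
    (hIJ : ∀ t ∈ I, t + n * T ∈ J) : IsSolutionOn G (fun t => v (t + n * T)) I := by
  refine ⟨fun a b hab hI => ?_, ?_⟩
  · refine absolutelyContinuousOnInterval_comp_add_right (h.1 _ _ (by linarith) fun t ht => ?_)
    have := hIJ (t - n * T) (hI ⟨by linarith [ht.1], by linarith [ht.2]⟩)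
    simpa using this
  · filter_upwards [ae_comp_add_right h.2 (n * T)] with t ht hmem
    obtain ⟨y, hy, hd⟩ := ht (hIJ t hmem)
    refine ⟨y, ?_, hd.comp_add_const t (n * T)⟩
    have heq : G (t + n * T) (v (t + n * T)) = G t (v (t + n * T)) :=
      (hper (v (t + n * T))).nat_mul n t
    rwa [← heq]

/-- On bounded sets `G` is one-sided Lipschitz: the monotone part only helps, and the Lipschitz
part contributes the constant. -/
theorem exists_oneSidedLipschitz (hS1 : StructuralS1 T G) (r : ℝ) :
    ∃ L : ℝ, ∀ (t : ℝ), ∀ u₁ ∈ Icc (-r) r, ∀ u₂ ∈ Icc (-r) r, ∀ y₁ ∈ G t u₁, ∀ y₂ ∈ G t u₂,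
      (y₂ - y₁) * (u₂ - u₁) ≤ L * (u₂ - u₁) ^ 2 := by
  obtain ⟨A, p, hA, hp, hG⟩ := hS1
  obtain ⟨L, hL⟩ := hp.locally_lipschitz r
  refine ⟨L, fun t u₁ hu₁ u₂ hu₂ y₁ hy₁ y₂ hy₂ => ?_⟩
  rw [hG] at hy₁ hy₂
  obtain ⟨a₁, ha₁, rfl⟩ := hy₁
  obtain ⟨a₂, ha₂, rfl⟩ := hy₂
  have hmono : 0 ≤ (a₂ - a₁) * (u₂ - u₁) := by
    rcases eq_or_ne u₁ u₂ with rfl | hne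
    · simp
    · exact (hA.maximal_monotone t).1 _ _ hne _ ha₁ _ ha₂
  have hlip : |p t u₂ - p t u₁| ≤ L * |u₂ - u₁| := by
    simpa [Real.dist_eq] using (hL t).dist_le_mul u₂ hu₂ u₁ hu₁
  have hp' : (p t u₂ - p t u₁) * (u₂ - u₁) ≤ L * (u₂ - u₁) ^ 2 := by
    calc (p t u₂ - p t u₁) * (u₂ - u₁) ≤ |p t u₂ - p t u₁| * |u₂ - u₁| := by
          rw [← abs_mul]; exact le_abs_self _
      _ ≤ L * |u₂ - u₁| * |u₂ - u₁| := by gcongr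
      _ = L * (u₂ - u₁) ^ 2 := by rw [mul_assoc, ← sq, sq_abs]
  linarith

theorem IsSolutionOn.isOneSidedLipschitz_sub {x y : ℝ → ℝ} {a b r L : ℝ} (hab : a ≤ b)
    (hL : ∀ (t : ℝ), ∀ u₁ ∈ Icc (-r) r, ∀ u₂ ∈ Icc (-r) r, ∀ y₁ ∈ G t u₁, ∀ y₂ ∈ G t u₂,
      (y₂ - y₁) * (u₂ - u₁) ≤ L * (u₂ - u₁) ^ 2)
    (hx : IsSolutionOn G x (Icc a b)) (hy : IsSolutionOn G y (Icc a b))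
    (hxr : ∀ t ∈ Icc a b, x t ∈ Icc (-r) r) (hyr : ∀ t ∈ Icc a b, y t ∈ Icc (-r) r) :
    IsOneSidedLipschitz L (fun t => y t - x t) a b := by
  refine ⟨(hy.1 a b hab Subset.rfl).fun_sub (hx.1 a b hab Subset.rfl), ?_⟩
  filter_upwards [hx.2, hy.2] with t htx hty hmem
  have hm := Ioo_subset_Icc_self hmem
  obtain ⟨x', hx', hdx⟩ := htx hm
  obtain ⟨y', hy', hdy⟩ := hty hm
  exact ⟨_, hdy.sub hdx, hL t _ (hxr t hm) _ (hyr t hm) _ hx' _ hy'⟩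

/-- Solutions keep their order. -/
theorem IsSolutionOn.le_of_le {x y : ℝ → ℝ} {a : ℝ} (hS1 : StructuralS1 T G)
    (hx : IsSolutionOn G x (Ici a)) (hy : IsSolutionOn G y (Ici a)) (hle : x a ≤ y a) {t : ℝ}
    (ht : a ≤ t) : x t ≤ y t := by
  have hx' := hx.mono ((Icc_subset_Ici_self : Icc a t ⊆ Ici a))
  have hy' := hy.mono ((Icc_subset_Ici_self : Icc a t ⊆ Ici a))
  obtain ⟨C, hC⟩ := (hx'.1 a t ht Subset.rfl).exists_bound
  obtain ⟨D, hD⟩ := (hy'.1 a t ht Subset.rfl).exists_bound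
  rw [uIcc_of_le ht] at hC hD
  obtain ⟨L, hL⟩ := exists_oneSidedLipschitz hS1 (max C D)
  have := (hx'.isOneSidedLipschitz_sub ht hL hy'
    (fun s hs => abs_le.1 ((hC s hs).trans (le_max_left _ _)))
    (fun s hs => abs_le.1 ((hD s hs).trans (le_max_right _ _)))).nonneg (sub_nonneg.2 hle)
    (right_mem_Icc.2 ht)
  simpa using this

/-- A bounded sequence of solutions whose initial values have finite total variation converges to
a solution. The functions `e^{-Lt} uₙ(t)` form a Cauchy sequence for the total variation norm, so
that the derivatives converge almost everywhere; no integrable bound on `G` is needed. -/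
theorem IsSolutionOn.of_tendsto {u : ℕ → ℝ → ℝ} {w : ℝ → ℝ} {a b r : ℝ} (hS1 : StructuralS1 T G)
    (hab : a ≤ b) (hu : ∀ n, IsSolutionOn G (u n) (Icc a b))
    (hr : ∀ n, ∀ t ∈ Icc a b, u n t ∈ Icc (-r) r)
    (hw : ∀ t ∈ Icc a b, Tendsto (fun n => u n t) atTop (𝓝 (w t)))
    (hs : Summable fun n => |u (n + 1) a - u n a|) : IsSolutionOn G w (Icc a b) := by
  obtain ⟨L, hL⟩ := exists_oneSidedLipschitz hS1 r
  have hac (n : ℕ) : AbsolutelyContinuousOnInterval (u n) a b := (hu n).1 a b hab Subset.rfl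
  have hd (n : ℕ) : IsOneSidedLipschitz L (fun t => u (n + 1) t - u n t) a b :=
    (hu n).isOneSidedLipschitz_sub hab hL (hu (n + 1)) (hr n) (hr (n + 1))
  set g : ℕ → ℝ → ℝ := fun n t => Real.exp (-L * t) * u n t with hg
  have hgac (n : ℕ) : AbsolutelyContinuousOnInterval (g n) a b :=
    (absolutelyContinuousOnInterval_exp_mul _).fun_mul (hac n)
  have hdiff : ∀ᵐ t ∂volume, t ∈ Ioo a b → ∀ n, ∃ y ∈ G t (u n t), HasDerivAt (u n) y t := by
    filter_upwards [ae_all_iff.2 fun n => (hu n).2] with t ht hmem n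
    exact ht n (Ioo_subset_Icc_self hmem)
  have hgs : Summable fun n => ∫ t in a..b, |deriv (g (n + 1)) t - deriv (g n) t| := by
    refine Summable.of_nonneg_of_le
      (fun n => intervalIntegral.integral_nonneg hab fun t _ => abs_nonneg _)
      (fun n => ?_) (hs.mul_left (Real.exp (-L * a)))
    refine le_of_eq_of_le ?_ ((hd n).integral_abs_deriv_le hab)
    refine intervalIntegral.integral_congr_ae_restrict ?_
    rw [uIoc_of_le hab, ← restrict_Ioo_eq_restrict_Ioc]
    refine (ae_restrict_iff' measurableSet_Ioo).2 ?_
    filter_upwards [hdiff] with t ht hmem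
    obtain ⟨y, -, hy⟩ := ht hmem n
    obtain ⟨z, -, hz⟩ := ht hmem (n + 1)
    have he := hasDerivAt_exp_mul (-L) t
    simp only [hg]
    rw [(he.fun_mul hy).deriv, (he.fun_mul hz).deriv, (he.fun_mul (hz.fun_sub hy)).deriv]
    ring_nf
  obtain ⟨hWac, hWd⟩ := absolutelyContinuousOnInterval_of_summable_variation
    (w := fun t => Real.exp (-L * t) * w t) hab hgac
    (fun t ht => (hw t ht).const_mul _) hgs
  have hweq : (fun t => Real.exp (L * t) * (Real.exp (-L * t) * w t)) = w := by
    funext t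
    rw [← mul_assoc, ← Real.exp_add]
    simp
  refine ⟨fun c e hce hsub => ?_, ?_⟩
  · have h1 := (absolutelyContinuousOnInterval_exp_mul L).fun_mul hWac
    rw [hweq] at h1
    exact h1.mono (by rwa [uIcc_of_le hce, uIcc_of_le hab])
  · obtain ⟨A, p, hA, hp, hG⟩ := hS1
    have hae : ∀ᵐ t ∂volume, t ∈ Icc a b → t ∈ Ioo a b := by
      filter_upwards [Measure.ae_ne volume a, Measure.ae_ne volume b] with t hta htb ht
      exact ⟨lt_of_le_of_ne ht.1 hta.symm, lt_of_le_of_ne ht.2 htb⟩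
    filter_upwards [hae, hdiff, hWd] with t htI ht hWt hmem
    obtain ⟨y, hy, hlim⟩ := hWt (htI hmem)
    choose q hqG hq using ht (htI hmem)
    have he := hasDerivAt_exp_mul L t
    have hder := he.fun_mul hy
    rw [hweq] at hder
    refine ⟨_, ?_, hder⟩
    set z := Real.exp (L * t) * L * (Real.exp (-L * t) * w t) + Real.exp (L * t) * y with hz
    have hexp : Real.exp (L * t) * Real.exp (-L * t) = 1 := by
      rw [← Real.exp_add]
      simp
    -- the derivatives `q n` of `u n` converge to the derivative of `w`
    have hqlim : Tendsto q atTop (𝓝 z) := by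
      have h1 := ((hw t hmem).const_mul (Real.exp (-L * t))).const_mul (Real.exp (L * t) * L)
      have h2 := h1.add (hlim.const_mul (Real.exp (L * t)))
      refine h2.congr fun n => ?_
      rw [((hasDerivAt_exp_mul (-L) t).fun_mul (hq n)).deriv]
      linear_combination (q n) * hexp
    have hq' (n : ℕ) : p t (u n t) - q n ∈ A t (u n t) := by
      have := hqG n
      rw [hG] at this
      obtain ⟨α, hα, hαq⟩ := this
      rwa [hαq, show p t (u n t) - (-α + p t (u n t)) = α by ring]
    have hplim : Tendsto (fun n => p t (u n t)) atTop (𝓝 (p t (w t))) :=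
      ((hp.continuous t).tendsto _).comp (hw t hmem)
    rw [hG]
    exact ⟨_, (hA.maximal_monotone t).mem_of_tendsto hq' (hw t hmem) (hplim.sub hqlim), by ring⟩

/-! ### A priori bounds -/

variable {R t₀ : ℝ} {lm lp v : ℝ → ℝ}

/-- The sign of the mean of `ℓ⁺` enters here: a solution that does not decrease over a period ends
it below `v₊`. -/
theorem StructuralS2.le_vPlus (hS2 : StructuralS2 T G R lm lp) (hT : 0 < T) {z : ℝ → ℝ} {s : ℝ}
    (hz : IsSolutionOn G z (Icc s (s + T))) (hle : z s ≤ z (s + T)) :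
    z (s + T) ≤ vPlus T R lp := by
  have habs : Function.Periodic (fun t => |lp t|) T := fun t => by
    simp only [hS2.periodic_lp t]
  have h1 := hS2.periodic_lp.intervalIntegral_add_eq s 0
  have h2 := habs.intervalIntegral_add_eq s 0
  rw [zero_add] at h1 h2
  rw [vPlus, ← h2]
  refine le_add_integral_abs_of_drift (by linarith) (hz.1 _ _ (by linarith) Subset.rfl)
    (hS2.periodic_lp.intervalIntegrable₀ hT.ne' hS2.integrable_lp _ _)
    (h1 ▸ hS2.integral_lp_neg) ?_ hle
  filter_upwards [hz.2, hS2.upper] with t ht hup hmem hR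
  obtain ⟨y, hy, hd⟩ := ht hmem
  exact ⟨y, hup _ hR y hy, hd⟩

theorem StructuralS2.vMinus_le (hS2 : StructuralS2 T G R lm lp) (hT : 0 < T) {z : ℝ → ℝ} {s : ℝ}
    (hz : IsSolutionOn G z (Icc s (s + T))) (hle : z (s + T) ≤ z s) :
    vMinus T R lm ≤ z (s + T) := by
  have habs : Function.Periodic (fun t => |lm t|) T := fun t => by
    simp only [hS2.periodic_lm t]
  have h1 := hS2.periodic_lm.intervalIntegral_add_eq s 0
  have h2 := habs.intervalIntegral_add_eq s 0
  rw [zero_add] at h1 h2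
  have := le_add_integral_abs_of_drift (z := -z) (R := R) (by linarith)
    (hz.1 s (s + T) (by linarith) Subset.rfl).neg
    (hS2.periodic_lm.intervalIntegrable₀ hT.ne' hS2.integrable_lm _ _)
    (h1 ▸ hS2.integral_lm_neg) (by
      filter_upwards [hz.2, hS2.lower] with t ht hlow hmem hR
      obtain ⟨y, hy, hd⟩ := ht hmem
      have hR' : z t ∈ Iic (-R) := by
        simp only [Pi.neg_apply] at hR
        exact le_neg.2 hR
      exact ⟨-y, neg_le.2 (hlow _ hR' y hy), hd.neg⟩) (by simpa using hle)
  rw [vMinus, ← h2]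
  simp only [Pi.neg_apply] at this
  linarith

/-! ### Convergence to a periodic solution -/

theorem IsSolutionOn.comp_add_period (hS1 : StructuralS1 T G) (hT : 0 < T)
    (hv : IsSolutionOn G v (Ici t₀)) : IsSolutionOn G (fun t => v (t + T)) (Ici t₀) := by
  simpa using hv.comp_add_nat_mul (periodic_of_structuralS1 hS1) 1 (I := Ici t₀)
    fun t (ht : t₀ ≤ t) => show t₀ ≤ t + (1 : ℕ) * T by push_cast; linarith

/-- By forward uniqueness, a solution and its translate by one period do not cross. -/
theorem IsSolutionOn.le_comp_add_period_or (hS1 : StructuralS1 T G) (hT : 0 < T)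
    (hv : IsSolutionOn G v (Ici t₀)) :
    (∀ t, t₀ ≤ t → v t ≤ v (t + T)) ∨ ∀ t, t₀ ≤ t → v (t + T) ≤ v t := by
  have hv' := hv.comp_add_period hS1 hT
  rcases le_total (v t₀) (v (t₀ + T)) with h | h
  · exact Or.inl fun t ht => hv.le_of_le hS1 hv' h ht
  · exact Or.inr fun t ht => hv'.le_of_le hS1 hv h ht

theorem monotone_comp_add_nat_mul (hT : 0 < T) (h : ∀ t, t₀ ≤ t → v t ≤ v (t + T)) {t : ℝ}
    (ht : t₀ ≤ t) : Monotone fun n : ℕ => v (t + n * T) := by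
  refine monotone_nat_of_le_succ fun n => ?_
  have hn : 0 ≤ (n : ℝ) * T := by positivity
  rw [show t + ((n + 1 : ℕ) : ℝ) * T = t + n * T + T by push_cast; ring]
  exact h _ (by linarith)

theorem antitone_comp_add_nat_mul (hT : 0 < T) (h : ∀ t, t₀ ≤ t → v (t + T) ≤ v t) {t : ℝ}
    (ht : t₀ ≤ t) : Antitone fun n : ℕ => v (t + n * T) := fun _ _ hmn =>
  neg_le_neg_iff.1 (monotone_comp_add_nat_mul (v := -v) hT (fun s hs => neg_le_neg (h s hs)) ht hmn)

theorem IsSolutionOn.monotone_or_antitone (hS1 : StructuralS1 T G) (hT : 0 < T)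
    (hv : IsSolutionOn G v (Ici t₀)) {t : ℝ} (ht : t₀ ≤ t) :
    Monotone (fun n : ℕ => v (t + n * T)) ∨ Antitone (fun n : ℕ => v (t + n * T)) :=
  (hv.le_comp_add_period_or hS1 hT).imp (fun h => monotone_comp_add_nat_mul hT h ht)
    fun h => antitone_comp_add_nat_mul hT h ht

theorem exists_nat_mul_add_mem_Ico (hT : 0 < T) {t : ℝ} (ht : t₀ ≤ t) :
    ∃ s ∈ Ico t₀ (t₀ + T), ∃ n : ℕ, t = s + n * T := by
  have h0 : 0 ≤ (t - t₀) / T := div_nonneg (sub_nonneg.2 ht) hT.le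
  have h1 := (le_div_iff₀ hT).1 (Nat.floor_le h0)
  have h2 := (div_lt_iff₀ hT).1 (Nat.lt_floor_add_one ((t - t₀) / T))
  exact ⟨t - ⌊(t - t₀) / T⌋₊ * T, ⟨by linarith, by linarith⟩, _, by ring⟩

/-- In the direction in which the translates move, the bound comes from `v₋` or `v₊`; in the other
one, from the values over the first period. -/
theorem IsSolutionOn.exists_bound (hS1 : StructuralS1 T G) (hS2 : StructuralS2 T G R lm lp)
    (hT : 0 < T) (hv : IsSolutionOn G v (Ici t₀)) :
    ∃ r, ∀ t, t₀ ≤ t → v t ∈ Icc (-r) r := by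
  obtain ⟨C, hC⟩ := (hv.1 t₀ (t₀ + T) (by linarith) Icc_subset_Ici_self).exists_bound
  rw [uIcc_of_le (by linarith)] at hC
  have hC' (s : ℝ) (hs : s ∈ Icc t₀ (t₀ + T)) : -C ≤ v s ∧ v s ≤ C := abs_le.1 (hC s hs)
  have hsol (t : ℝ) (ht : t₀ ≤ t) : IsSolutionOn G v (Icc t (t + T)) :=
    hv.mono fun s hs => ht.trans hs.1
  refine ⟨max C (max (vPlus T R lp) (-vMinus T R lm)), fun t ht => ?_⟩
  rw [mem_Icc, neg_le, le_max_iff, le_max_iff, le_max_iff, le_max_iff, neg_le, neg_le_neg_iff]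
  obtain ⟨s, hs, n, hn⟩ := exists_nat_mul_add_mem_Ico hT ht
  have hsI := Ico_subset_Icc_self hs
  rcases hv.le_comp_add_period_or hS1 hT with h | h
  · have hmono : v s ≤ v t := by
      simpa [hn] using monotone_comp_add_nat_mul hT h hs.1 (Nat.zero_le n)
    refine ⟨Or.inl (by linarith [hC' s hsI]), ?_⟩
    rcases le_total t (t₀ + T) with hle | hle
    · exact Or.inl (hC' t ⟨ht, hle⟩).2
    · have h1 := h (t - T) (by linarith)
      have := hS2.le_vPlus hT (hsol (t - T) (by linarith)) h1
      rw [sub_add_cancel] at this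
      exact Or.inr (Or.inl this)
  · have hanti : v t ≤ v s := by
      simpa [hn] using antitone_comp_add_nat_mul hT h hs.1 (Nat.zero_le n)
    refine ⟨?_, Or.inl (by linarith [hC' s hsI])⟩
    rcases le_total t (t₀ + T) with hle | hle
    · exact Or.inl (by linarith [hC' t ⟨ht, hle⟩])
    · have h1 := h (t - T) (by linarith)
      have := hS2.vMinus_le hT (hsol (t - T) (by linarith)) h1
      rw [sub_add_cancel] at this
      exact Or.inr (Or.inr this)

theorem summable_abs_sub_of_monotone_or_antitone {x : ℕ → ℝ} {r : ℝ}
    (hx : Monotone x ∨ Antitone x) (hr : ∀ n, x n ∈ Icc (-r) r) :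
    Summable fun n => |x (n + 1) - x n| := by
  refine summable_of_sum_range_le (c := 2 * r) (fun n => abs_nonneg _) fun n => ?_
  rcases hx with h | h
  · simp_rw [fun i => abs_of_nonneg (sub_nonneg.2 (h (Nat.le_succ i)))]
    rw [Finset.sum_range_sub]
    linarith [(hr n).2, (hr 0).1]
  · simp_rw [fun i => abs_of_nonpos (sub_nonpos.2 (h (Nat.le_succ i))), Finset.sum_neg_distrib]
    rw [Finset.sum_range_sub]
    linarith [(hr n).1, (hr 0).2]

theorem exists_tendsto_of_monotone_or_antitone {x : ℕ → ℝ} {r : ℝ}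
    (hx : Monotone x ∨ Antitone x) (hr : ∀ n, x n ∈ Icc (-r) r) :
    ∃ l, Tendsto x atTop (𝓝 l) := by
  rcases hx with h | h
  · exact ⟨_, tendsto_atTop_ciSup h ⟨r, forall_mem_range.2 fun n => (hr n).2⟩⟩
  · exact ⟨_, tendsto_atTop_ciInf h ⟨-r, forall_mem_range.2 fun n => (hr n).1⟩⟩

/-- The translates of a solution by multiples of the period converge to a periodic solution. -/
theorem IsSolutionOn.exists_periodic_limit (hS1 : StructuralS1 T G)
    (hS2 : StructuralS2 T G R lm lp) (hT : 0 < T) (hv : IsSolutionOn G v (Ici t₀)) :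
    ∃ w : ℝ → ℝ, IsSolutionOn G w univ ∧ Function.Periodic w T ∧
      ∀ t, Tendsto (fun n : ℕ => v (t + n * T)) atTop (𝓝 (w t)) := by
  obtain ⟨r, hr⟩ := hv.exists_bound hS1 hS2 hT
  have hN (a : ℝ) : ∃ N : ℕ, t₀ ≤ a + N * T := by
    obtain ⟨N, hN⟩ := exists_nat_ge ((t₀ - a) / T)
    exact ⟨N, by linarith [(div_le_iff₀ hT).1 hN]⟩
  have hge {s : ℝ} (hs : t₀ ≤ s) (n : ℕ) : t₀ ≤ s + n * T := by
    have : 0 ≤ (n : ℝ) * T := by positivity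
    linarith
  have hassoc (t : ℝ) (n N : ℕ) : t + ((n + N : ℕ) : ℝ) * T = t + N * T + n * T := by
    push_cast
    ring
  have hlim (t : ℝ) : ∃ l, Tendsto (fun n : ℕ => v (t + n * T)) atTop (𝓝 l) := by
    obtain ⟨N, hNt⟩ := hN t
    obtain ⟨l, hl⟩ := exists_tendsto_of_monotone_or_antitone
      (hv.monotone_or_antitone hS1 hT hNt) fun n => hr _ (hge hNt n)
    refine ⟨l, (tendsto_add_atTop_iff_nat N).1 ?_⟩
    simpa only [hassoc] using hl
  choose w hw using hlim
  refine ⟨w, isSolutionOn_univ fun a b hab => ?_, fun t => ?_, hw⟩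
  · obtain ⟨N, hNa⟩ := hN a
    have hNs {s : ℝ} (hs : s ∈ Icc a b) : t₀ ≤ s + N * T := by linarith [hs.1]
    refine IsSolutionOn.of_tendsto (u := fun n t => v (t + ((n + N : ℕ) : ℝ) * T)) (r := r)
      hS1 hab (fun n => ?_) (fun n t ht => ?_) (fun t _ => ?_) ?_
    · refine hv.comp_add_nat_mul (periodic_of_structuralS1 hS1) (n + N) fun t ht => ?_
      rw [hassoc]
      exact hge (hNs ht) n
    · rw [hassoc]
      exact hr _ (hge (hNs ht) n)
    · exact (tendsto_add_atTop_iff_nat (f := fun n : ℕ => v (t + n * T)) N).2 (hw t)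
    · simp_rw [hassoc _ _ N]
      exact summable_abs_sub_of_monotone_or_antitone (x := fun n : ℕ => v (a + N * T + n * T))
        (hv.monotone_or_antitone hS1 hT hNa) fun n => hr _ (hge hNa n)
  · refine tendsto_nhds_unique (hw (t + T)) ?_
    have := (tendsto_add_atTop_iff_nat (f := fun n : ℕ => v (t + n * T)) 1).2 (hw t)
    simpa only [hassoc, Nat.cast_one, one_mul] using this

/-- A periodic initial value is a fixed point of the Poincaré map, hence lies in all iterated images
once it lies in `[v₋, v₊]`. -/
theorem mem_attractor_of_periodic {w : ℝ → ℝ} (hS2 : StructuralS2 T G R lm lp) (hT : 0 < T)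
    (hw : IsSolutionOn G w univ) (hper : Function.Periodic w T) :
    w 0 ∈ attractor T G R lm lp := by
  have hsol : IsSolutionOn G w (Icc 0 (0 + T)) := hw.mono (subset_univ _)
  have h0 : w (0 + T) = w 0 := hper 0
  have hmem : w 0 ∈ Icc (vMinus T R lm) (vPlus T R lp) :=
    ⟨h0 ▸ hS2.vMinus_le hT hsol h0.le, h0 ▸ hS2.le_vPlus hT hsol h0.ge⟩
  have hfix : w 0 ∈ poincare T G (w 0) :=
    ⟨w, hw.mono (subset_univ _), rfl, by simpa using h0⟩
  refine mem_iInter.2 fun i => ?_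
  induction i with
  | zero => exact hmem
  | succ i ih =>
    rw [Function.iterate_succ_apply']
    exact mem_iUnion₂.2 ⟨w 0, ih, hfix⟩

/-- Grönwall's inequality over one period turns convergence of `v(s + nT)` at one time `s` into
uniform convergence over the period. -/
theorem IsSolutionOn.tendsto_sub_periodic (hS1 : StructuralS1 T G)
    (hS2 : StructuralS2 T G R lm lp) (hT : 0 < T) (hv : IsSolutionOn G v (Ici t₀)) {w : ℝ → ℝ}
    (hw : IsSolutionOn G w univ) (hper : Function.Periodic w T)
    (hlim : Tendsto (fun n : ℕ => v (t₀ + n * T)) atTop (𝓝 (w t₀))) :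
    Tendsto (fun t => v t - w t) atTop (𝓝 0) := by
  obtain ⟨r₁, hr₁⟩ := hv.exists_bound hS1 hS2 hT
  obtain ⟨r₂, hr₂⟩ := (hw.mono (subset_univ (Ici t₀))).exists_bound hS1 hS2 hT
  obtain ⟨L, hL⟩ := exists_oneSidedLipschitz hS1 (max r₁ r₂)
  have hmono {r x : ℝ} (hle : r ≤ max r₁ r₂) (hx : x ∈ Icc (-r) r) :
      x ∈ Icc (-(max r₁ r₂)) (max r₁ r₂) := Icc_subset_Icc (neg_le_neg hle) hle hx
  have hd {s t : ℝ} (hs : t₀ ≤ s) (hst : s ≤ t) :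
      |v t - w t| ≤ Real.exp (L * (t - s)) * |v s - w s| := by
    refine IsOneSidedLipschitz.abs_le (d := fun t => v t - w t) ?_ hst
    exact IsSolutionOn.isOneSidedLipschitz_sub hst hL (hw.mono (subset_univ _))
      (hv.mono fun x hx => hs.trans hx.1)
      (fun x hx => hmono (le_max_right _ _) (hr₂ x (hs.trans hx.1)))
      (fun x hx => hmono (le_max_left _ _) (hr₁ x (hs.trans hx.1)))
  have hseq : Tendsto (fun n : ℕ => Real.exp (|L| * T) * |v (t₀ + n * T) - w t₀|) atTop (𝓝 0) := by
    simpa using ((hlim.sub_const (w t₀)).abs).const_mul (Real.exp (|L| * T))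
  rw [Metric.tendsto_atTop]
  intro ε hε
  obtain ⟨N, hN⟩ := (hseq.eventually (gt_mem_nhds hε)).exists_forall_of_atTop
  refine ⟨t₀ + N * T, fun t ht => ?_⟩
  obtain ⟨s, hs, n, hn⟩ := exists_nat_mul_add_mem_Ico hT ht
  have hk : 0 ≤ ((n + N : ℕ) : ℝ) * T := by positivity
  have hcast : ((n + N : ℕ) : ℝ) * T = n * T + N * T := by push_cast; ring
  have h1 := hd (s := t₀ + ((n + N : ℕ) : ℝ) * T) (t := t) (by linarith) (by linarith [hs.1])
  have h2 : w (t₀ + ((n + N : ℕ) : ℝ) * T) = w t₀ := hper.nat_mul (n + N) t₀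
  rw [h2] at h1
  rw [dist_zero_right, Real.norm_eq_abs]
  refine h1.trans_lt (lt_of_le_of_lt ?_ (hN (n + N) (Nat.le_add_left N n)))
  refine mul_le_mul_of_nonneg_right (Real.exp_le_exp.2 ?_) (abs_nonneg _)
  exact mul_le_mul (le_abs_self L) (by linarith [hs.2]) (by linarith [hs.1]) (abs_nonneg L)

end PeriodicInclusion

theorem mainTheorem7 (T : ℝ) (hT : 0 < T) (G : ℝ → ℝ → Set ℝ) (R : ℝ) (lm lp : ℝ → ℝ)
    (hS1 : PeriodicInclusion.StructuralS1 T G)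
    (hS2 : PeriodicInclusion.StructuralS2 T G R lm lp)
    (t₀ : ℝ) (v : ℝ → ℝ) (hv : PeriodicInclusion.IsSolutionOn G v (Set.Ici t₀)) :
    ∃ vstar : ℝ → ℝ,
      PeriodicInclusion.IsSolutionOn G vstar Set.univ ∧
      Function.Periodic vstar T ∧
      vstar 0 ∈ PeriodicInclusion.attractor T G R lm lp ∧
      Filter.Tendsto (fun t => v t - vstar t) Filter.atTop (nhds 0) := by
  obtain ⟨w, hw, hper, hlim⟩ := hv.exists_periodic_limit hS1 hS2 hT
  exact ⟨w, hw, hper, PeriodicInclusion.mem_attractor_of_periodic hS2 hT hw hper,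
    hv.tendsto_sub_periodic hS1 hS2 hT hw hper (hlim t₀)⟩
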